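/- Let $\mathcal X$ be a measurable space, $\mathcal Y$ a finite label set with $|\mathcal Y|\ge 2$, and $\phi:\mathcal X\times\mathcal Y\to\mathbb R^n$ a measurable feature map. For $w\in\mathbb R^n$ the linear model gives label $y$ the score $\langle w,\phi(x,y)\rangle$ at $x$; its margin at $(x,y)$ is $M(x,y;w)=\langle w,\phi(x,y)\rangle-\max_{y'\ne y}\langle w,\phi(x,y')\rangle$. A predictor of the model is any $h:\mathcal X\to\mathcal Y$ with $h(x)\in\arg\max_{y}\langle w,\phi(x,y)\rangle$ for all $x$, and $e_D(h)=\mathbb P_{(x,y)\sim D}[h(x)\ne y]$ is its misclassification error under a probability distribution $D$ on $\mathcal X\times\mathcal Y$. Let $P=N(0,I)$ be the Gaussian prior on $\mathbb R^n$ and $Q_w=N(w,I)$ the Gaussian posterior centred at $w$. For a sample $S$ of $m$ points, $\mathbb P_{(x,y)\sim S}$ denotes the fraction of points of $S$ with the stated property. **Theorem 3 (Generalisation Margin Bound).** There are absolute constants $C,c>0$ such that the following holds for all $\mathcal X,\mathcal Y,n,\phi,D$ as above, all $m\ge 1$, $\delta\in(0,1]$, $\gamma>0$ and $\alpha\in[0,1)$.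 (a) For every $w\in\mathbb R^n$, with probability at least $1-\delta$ over $S\sim D^m$, every predictor $h$ of the model $w$ satisfies $$e_D(h)\le \mathbb P_{(x,y)\sim S}\big(\mathbb E_{w'\sim Q_w}M(x,y;w')\le\gamma\big)+C\sqrt{\frac{\frac{\|w\|^2}{2c(1-\alpha)\gamma^2}\ln(m|\mathcal Y|)+\ln m+\ln\delta^{-1}}{m}} .$$ (b) If moreover $\|\phi(x,y)\|\le R$ for all $x,y$, where $R>0$, then the bound holds uniformly in $w$ with $c$ replaced by $c/R^2$: with probability at least $1-\delta$ over $S\sim D^m$, simultaneously for all $w\in\mathbb R^n$ and all predictors $h$ of the model $w$, $$e_D(h)\le \mathbb P_{(x,y)\sim S}\big(\mathbb E_{w'\sim Q_w}M(x,y;w')\le\gamma\big)+C\sqrt{\frac{\frac{R^2\|w\|^2}{2c(1-\alpha)\gamma^2}\ln(m|\mathcal Y|)+\ln m+\ln\delta^{-1}}{m}} .$$ The case $\alpha=0$ is a margin bound for SVMs. -/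

import Mathlib

open MeasureTheory ProbabilityTheory

noncomputable section

namespace MarginBound

/-- Scores of a linear model with weight vector `w` and joint feature map `φ`:
the label `y` gets the score `⟨w, φ(x, y)⟩` at the observation `x`. -/
def score {X Y : Type*} {n : ℕ} (φ : X → Y → EuclideanSpace ℝ (Fin n))
    (w : EuclideanSpace ℝ (Fin n)) (x : X) (y : Y) : ℝ :=
  inner ℝ w (φ x y)

/-- Margin of a score vector `f` at the label `y`: the score of `y` minus the largest score of
another label (a maximum over a finite set, which is nonempty when there are two labels). -/
def margin {Y : Type*} (f : Y → ℝ) (y : Y) : ℝ :=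
  f y - ⨆ y' : {y' : Y // y' ≠ y}, f y'

/-- `h` is a predictor of the model `f`: it always answers a label of maximal score
(ties are broken arbitrarily). -/
def IsArgmaxPredictor {X Y : Type*} (f : X → Y → ℝ) (h : X → Y) : Prop :=
  ∀ x y, f x y ≤ f x (h x)

/-- Misclassification error of the predictor `h` under the data distribution `D`. -/
def misclassificationError {X Y : Type*} [MeasurableSpace X] [MeasurableSpace Y]
    (D : Measure (X × Y)) (h : X → Y) : ℝ :=
  D.real {z | h z.1 ≠ z.2}

/-- The Gaussian prior `N(0, I)` over weight vectors. -/
def prior (n : ℕ) : Measure (EuclideanSpace ℝ (Fin n)) :=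
  stdGaussian (EuclideanSpace ℝ (Fin n))

/-- The Gaussian posterior `N(w, I)`: the prior translated by `w`. -/
def posterior {n : ℕ} (w : EuclideanSpace ℝ (Fin n)) : Measure (EuclideanSpace ℝ (Fin n)) :=
  (prior n).map (fun v => w + v)

/-- Expected margin `𝔼_{w' ∼ N(w, I)} M(x, y; w')` at the labelled observation `z = (x, y)`. -/
def expectedMargin {X Y : Type*} {n : ℕ} (φ : X → Y → EuclideanSpace ℝ (Fin n))
    (w : EuclideanSpace ℝ (Fin n)) (z : X × Y) : ℝ :=
  ∫ w', margin (score φ w' z.1) z.2 ∂(posterior w)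

/-- Fraction of the points of the sample `S` that lie in `B`. -/
def empiricalProb {Z : Type*} {m : ℕ} (S : Fin m → Z) (B : Set Z) : ℝ :=
  (∑ i, B.indicator (fun _ => (1 : ℝ)) (S i)) / m

/-- The law of `m` independent draws from `D`. -/
def iidSample {Z : Type*} [MeasurableSpace Z] (D : Measure Z) (m : ℕ) : Measure (Fin m → Z) :=
  Measure.pi (fun _ => D)

/-- The event `E` has probability at least `p` (if `E` is not measurable, it contains a measurable
event of probability at least `p`). -/
def ProbAtLeast {Ω : Type*} [MeasurableSpace Ω] (μ : Measure Ω) (p : ℝ) (E : Set Ω) : Prop :=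
  ∃ A ⊆ E, MeasurableSet A ∧ p ≤ μ.real A

/-- The expression under the `O` with constant `c`:
`√(((‖w‖² / (2 c (1 - α) γ²)) ln (m k) + ln m + ln (1/δ)) / m)`, for `k` labels. -/
def rate {n : ℕ} (c α γ δ : ℝ) (m k : ℕ) (w : EuclideanSpace ℝ (Fin n)) : ℝ :=
  √((‖w‖ ^ 2 / (2 * c * (1 - α) * γ ^ 2) * Real.log (m * k) + Real.log m + Real.log δ⁻¹) / m)

end MarginBound

end

/-! ### Gaussian measures: translation, tails and relative entropy. -/

namespace MarginBound

open scoped ENNReal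

/-! The margin is a minimum of linear forms in the weights, hence concave, and the Gaussian noise is
centred. By Jensen the expected margin is at most the margin at `w` (`expectedMargin_le_margin`), so
the empirical term dominates the frequency of margins at most `γ`, while an error forces a margin at
most `0`. For a fixed `w`, Hoeffding's inequality for the event "margin at most `0`" suffices; the
norm term is slack.

For all `w` at once, the PAC-Bayes bound `probAtLeast_pacBayes` is applied to the posteriors N(tw,
I) and the loss "margin at most θ", with t = 2θ/γ, θ² = 8R² ln(mk) and k labels. Feature differences
have norm at most 2R, so the noise along one of them reaches θ with probability at most 1/(mk).
Hence an error has loss at least 1 - 1/(mk), whereas a point of margin above γ, thus above 2θ after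
scaling, has loss at most 1/m by a union bound over labels. The relative entropy is t²‖w‖²/2 =
16(R‖w‖/γ)² ln(mk), and tuning the inverse temperature over m grid values costs ln m. -/

lemma pi_withDensity_prod {ι : Type*} [Fintype ι] (μ : ι → Measure ℝ)
    [∀ i, IsProbabilityMeasure (μ i)] (f : ι → ℝ → ℝ≥0∞) (hf : ∀ i, Measurable (f i))
    [∀ i, SigmaFinite ((μ i).withDensity (f i))] :
    (Measure.pi μ).withDensity (fun x => ∏ i, f i (x i))
      = Measure.pi (fun i => (μ i).withDensity (f i)) := by
  refine (Measure.pi_eq fun s hs => ?_).symm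
  -- On a box the density integrates to the expectation of a product of functions of independent
  -- coordinates, which factorises.
  have hind : iIndepFun (fun i (x : ι → ℝ) => (s i).indicator (f i) (x i)) (Measure.pi μ) :=
    iIndepFun_pi (X := fun i => (s i).indicator (f i))
      fun i => ((hf i).indicator (hs i)).aemeasurable
  have hbox : (fun x : ι → ℝ => (Set.univ.pi s).indicator (fun x => ∏ i, f i (x i)) x)
      = fun x => ∏ i, (s i).indicator (f i) (x i) := by
    classical
    ext x
    by_cases hx : x ∈ Set.univ.pi s
    · rw [Set.indicator_of_mem hx]
      exact Finset.prod_congr rfl fun i _ => (Set.indicator_of_mem (hx i trivial) _).symm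
    · rw [Set.indicator_of_notMem hx]
      simp only [Set.mem_univ_pi, not_forall] at hx
      obtain ⟨i, hi⟩ := hx
      exact (Finset.prod_eq_zero (Finset.mem_univ i) (Set.indicator_of_notMem hi _)).symm
  rw [withDensity_apply _ (MeasurableSet.univ_pi hs), ← lintegral_indicator
    (MeasurableSet.univ_pi hs), hbox, lintegral_prod_eq_prod_lintegral_of_indepFun Finset.univ
    (fun i (x : ι → ℝ) => (s i).indicator (f i) (x i)) hind
    (fun i => ((hf i).indicator (hs i)).comp (measurable_pi_apply i))]
  refine Finset.prod_congr rfl fun i _ => ?_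
  rw [(measurePreserving_eval μ i).lintegral_comp ((hf i).indicator (hs i)),
    lintegral_indicator (hs i), withDensity_apply _ (hs i)]

lemma gaussianReal_withDensity_exp (a : ℝ) :
    (gaussianReal 0 1).withDensity (fun x => ENNReal.ofReal (Real.exp (a * x - a ^ 2 / 2)))
      = gaussianReal a 1 := by
  rw [gaussianReal_of_var_ne_zero _ one_ne_zero, gaussianReal_of_var_ne_zero _ one_ne_zero,
    ← withDensity_mul _ (measurable_gaussianPDF 0 1) (by fun_prop)]
  congr 1
  ext x
  simp only [Pi.mul_apply, gaussianPDF_def]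
  rw [← ENNReal.ofReal_mul (gaussianPDFReal_nonneg _ _ _)]
  congr 1
  simp only [gaussianPDFReal_def, NNReal.coe_one, mul_assoc, ← Real.exp_add]
  ring_nf

instance (n : ℕ) : IsProbabilityMeasure (prior n) := by unfold prior; infer_instance

instance (n : ℕ) : IsGaussian (prior n) := by unfold prior; infer_instance

/-- The Cameron–Martin formula for the standard Gaussian measure. -/
lemma lintegral_prior_add {n : ℕ} (u : EuclideanSpace ℝ (Fin n))
    {g : EuclideanSpace ℝ (Fin n) → ℝ≥0∞} (hg : Measurable g) :
    ∫⁻ v, g (u + v) ∂prior n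
      = ∫⁻ v, ENNReal.ofReal (Real.exp (inner ℝ u v - ‖u‖ ^ 2 / 2)) * g v ∂prior n := by
  have hpi : (Measure.pi fun _ : Fin n => gaussianReal 0 1).map (fun x i => u i + x i)
      = (Measure.pi fun _ : Fin n => gaussianReal 0 1).withDensity
        (fun x => ∏ i, ENNReal.ofReal (Real.exp (u i * x i - u i ^ 2 / 2))) := by
    have : ∀ i : Fin n, IsProbabilityMeasure ((gaussianReal 0 1).map (fun x => u i + x)) :=
      fun i => Measure.isProbabilityMeasure_map (by fun_prop)
    have : ∀ i : Fin n, SigmaFinite ((gaussianReal 0 1).withDensity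
        (fun x => ENNReal.ofReal (Real.exp (u i * x - u i ^ 2 / 2)))) := fun i => by
      rw [gaussianReal_withDensity_exp]; infer_instance
    rw [pi_withDensity_prod (fun _ => gaussianReal 0 1)
      (fun i x => ENNReal.ofReal (Real.exp (u i * x - u i ^ 2 / 2))) (fun i => by fun_prop),
      Measure.pi_map_pi (f := fun i x => u i + x) (fun i => by fun_prop)]
    congr 1
    ext1 i
    rw [gaussianReal_withDensity_exp, gaussianReal_map_const_add, zero_add]
  have hm : Measurable (WithLp.toLp 2 : (Fin n → ℝ) → EuclideanSpace ℝ (Fin n)) := by fun_prop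
  have hg' : Measurable fun x : Fin n → ℝ => g (WithLp.toLp 2 x) := hg.comp hm
  rw [prior, ← map_pi_eq_stdGaussian, lintegral_map (by fun_prop) hm,
    lintegral_map (by fun_prop) hm]
  have h1 : ∫⁻ x, g (u + WithLp.toLp 2 x) ∂(Measure.pi fun _ : Fin n => gaussianReal 0 1)
      = ∫⁻ x, g (WithLp.toLp 2 x)
        ∂((Measure.pi fun _ : Fin n => gaussianReal 0 1).map (fun x i => u i + x i)) := by
    rw [lintegral_map hg' (by fun_prop)]
    rfl
  rw [h1, hpi, lintegral_withDensity_eq_lintegral_mul _ (by fun_prop) hg']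
  refine lintegral_congr fun x => ?_
  rw [Pi.mul_apply, ← ENNReal.ofReal_prod_of_nonneg fun i _ => (Real.exp_pos _).le,
    ← Real.exp_sum, Finset.sum_sub_distrib, ← Finset.sum_div, EuclideanSpace.norm_sq_eq]
  simp [PiLp.inner_apply, mul_comm]

lemma map_inner_prior {n : ℕ} (u : EuclideanSpace ℝ (Fin n)) :
    (prior n).map (fun v => inner ℝ u v) = gaussianReal 0 (‖u‖₊ ^ 2) := by
  have h := IsGaussian.map_eq_gaussianReal (μ := prior n) (innerSL ℝ u)
  have h2 := variance_dual_stdGaussian (innerSL ℝ u)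
  have h3 := integral_strongDual_stdGaussian (innerSL ℝ u)
  rw [← prior] at h2 h3
  rw [h2, h3, innerSL_apply_norm] at h
  rw [← coe_nnnorm, ← NNReal.coe_pow, Real.toNNReal_coe] at h
  exact h

/-- The parameter may exceed the variance `‖u‖ ^ 2`, so a mere bound on the norm yields a tail
estimate. -/
lemma hasSubgaussianMGF_inner_prior {n : ℕ} (u : EuclideanSpace ℝ (Fin n)) (c : NNReal)
    (hc : ‖u‖ ^ 2 ≤ c) : HasSubgaussianMGF (fun v => inner ℝ u v) c (prior n) where
  integrable_exp_mul t := by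
    have h : Integrable (fun x => Real.exp (t * x)) ((prior n).map (fun v => inner ℝ u v)) := by
      rw [map_inner_prior]; exact integrable_exp_mul_gaussianReal t
    exact h.comp_measurable (by fun_prop)
  mgf_le t := by
    rw [mgf_gaussianReal (map_inner_prior u)]
    refine Real.exp_le_exp.2 ?_
    rw [NNReal.coe_pow, coe_nnnorm]
    nlinarith [sq_nonneg t]

/-- The Donsker–Varadhan inequality for the pair `N(u, I)`, `N(0, I)`, whose relative entropy is
`‖u‖² / 2`. -/
lemma exp_integral_posterior_le {n : ℕ} (u : EuclideanSpace ℝ (Fin n))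
    {f : EuclideanSpace ℝ (Fin n) → ℝ} (hf : Measurable f) {K : ℝ} (hK : ∀ v, |f v| ≤ K) :
    ENNReal.ofReal (Real.exp (∫ v, f (u + v) ∂prior n - ‖u‖ ^ 2 / 2))
      ≤ ∫⁻ v, ENNReal.ofReal (Real.exp (f v)) ∂prior n := by
  have hsub := hasSubgaussianMGF_inner_prior u (‖u‖₊ ^ 2) (by simp)
  have hshift : ∫⁻ v, ENNReal.ofReal (Real.exp (f v)) ∂prior n
      = ∫⁻ v, ENNReal.ofReal (Real.exp (f (u + v) - inner ℝ u v - ‖u‖ ^ 2 / 2)) ∂prior n := by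
    -- Translation by `-u` recentres the integrand at `u`; Jensen's inequality for `exp` then
    -- concludes, the linear term having mean zero.
    have h := lintegral_prior_add (-u)
      (g := fun v => ENNReal.ofReal (Real.exp (f (u + v)))) (by fun_prop)
    simp only [add_neg_cancel_left] at h
    rw [h]
    refine lintegral_congr fun v => ?_
    rw [← ENNReal.ofReal_mul (Real.exp_pos _).le, ← Real.exp_add, inner_neg_left, norm_neg]
    ring_nf
  have hfi : Integrable (fun v => f (u + v)) (prior n) :=
    Integrable.of_bound (hf.comp (by fun_prop)).aestronglyMeasurable K (ae_of_all _ fun v => hK _)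
  have hli : Integrable (fun v => (inner ℝ u v : ℝ)) (prior n) := hsub.integrable
  have hgi : Integrable (fun v => f (u + v) - inner ℝ u v - ‖u‖ ^ 2 / 2) (prior n) :=
    (hfi.sub hli).sub (integrable_const _)
  have hei : Integrable (fun v => Real.exp (f (u + v) - inner ℝ u v - ‖u‖ ^ 2 / 2))
      (prior n) := by
    refine ((hsub.integrable_exp_mul (-1)).const_mul (Real.exp K)).mono' (by fun_prop)
      (ae_of_all _ fun v => ?_)
    rw [Real.norm_eq_abs, abs_of_pos (Real.exp_pos _), ← Real.exp_add]
    refine Real.exp_le_exp.2 ?_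
    have := (abs_le.1 (hK (u + v))).2
    nlinarith [sq_nonneg ‖u‖]
  have hint : ∫ v, (f (u + v) - inner ℝ u v - ‖u‖ ^ 2 / 2) ∂prior n
      = ∫ v, f (u + v) ∂prior n - ‖u‖ ^ 2 / 2 := by
    rw [integral_sub (f := fun v => f (u + v) - inner ℝ u v) (hfi.sub hli) (integrable_const _),
      integral_sub hfi hli]
    have h3 : ∫ v, (inner ℝ u v : ℝ) ∂prior n = 0 :=
      integral_strongDual_stdGaussian (innerSL ℝ u)
    simp [h3]
  rw [hshift, ← ofReal_integral_eq_lintegral_ofReal hei (ae_of_all _ fun v => (Real.exp_pos _).le),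
    ← hint]
  exact ENNReal.ofReal_le_ofReal (convexOn_exp.map_integral_le Real.continuous_exp.continuousOn
    isClosed_univ (ae_of_all _ fun _ => trivial) hgi hei)

lemma prior_inner_ge_le {n : ℕ} (u : EuclideanSpace ℝ (Fin n)) {r s : ℝ} (hu : ‖u‖ ≤ r)
    (hs : 0 ≤ s) :
    (prior n).real {v | s ≤ inner ℝ u v} ≤ Real.exp (-s ^ 2 / (2 * r ^ 2)) := by
  have hr : 0 ≤ r := (norm_nonneg u).trans hu
  have h := (hasSubgaussianMGF_inner_prior u ⟨r ^ 2, sq_nonneg r⟩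
    (pow_le_pow_left₀ (norm_nonneg u) hu 2)).measure_ge_le hs
  exact h

end MarginBound

/-! ### Concentration of empirical probabilities and the PAC-Bayes bound. -/

namespace MarginBound

open scoped ENNReal

variable {Z : Type*} [MeasurableSpace Z]

instance (D : Measure Z) [IsProbabilityMeasure D] (m : ℕ) :
    IsProbabilityMeasure (iidSample D m) := by unfold iidSample; infer_instance

lemma empiricalProb_mono {Z : Type*} {m : ℕ} (S : Fin m → Z) {A B : Set Z} (h : A ⊆ B) :
    empiricalProb S A ≤ empiricalProb S B := by
  unfold empiricalProb
  gcongr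

lemma empiricalProb_nonneg {Z : Type*} {m : ℕ} (S : Fin m → Z) (B : Set Z) :
    0 ≤ empiricalProb S B :=
  div_nonneg (Finset.sum_nonneg fun _ _ => Set.indicator_nonneg (fun _ _ => zero_le_one) _)
    m.cast_nonneg

lemma empiricalProb_le_one {Z : Type*} {m : ℕ} (S : Fin m → Z) (B : Set Z) :
    empiricalProb S B ≤ 1 := by
  refine div_le_one_of_le₀ ?_ m.cast_nonneg
  calc ∑ i, B.indicator (fun _ => (1 : ℝ)) (S i) ≤ ∑ _i : Fin m, (1 : ℝ) :=
        Finset.sum_le_sum fun i _ => Set.indicator_le_self' (fun _ _ => zero_le_one) _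
    _ = m := by simp

lemma empiricalProb_univ {Z : Type*} {m : ℕ} (hm : 1 ≤ m) (S : Fin m → Z) :
    empiricalProb S Set.univ = 1 := by
  have : (m : ℝ) ≠ 0 := by positivity
  simp [empiricalProb, this]

/-- Hoeffding's lemma for the deviation of an empirical probability. -/
lemma hasSubgaussianMGF_sum_gap (D : Measure Z) [IsProbabilityMeasure D] (m : ℕ) {B : Set Z}
    (hB : MeasurableSet B) :
    HasSubgaussianMGF (fun S : Fin m → Z =>
      ∑ i, (D.real B - B.indicator (fun _ => (1 : ℝ)) (S i))) (m / 4) (iidSample D m) := by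
  have hmeas : Measurable (B.indicator fun _ => (1 : ℝ)) := measurable_const.indicator hB
  have h1 : HasSubgaussianMGF (fun z => D.real B - B.indicator (fun _ => (1 : ℝ)) z) (1 / 4) D := by
    have h := (hasSubgaussianMGF_of_mem_Icc (μ := D) (a := 0) (b := 1) hmeas.aemeasurable
      (ae_of_all _ fun z => ⟨Set.indicator_nonneg (fun _ _ => zero_le_one) _,
        Set.indicator_le_self' (fun _ _ => zero_le_one) _⟩)).neg
    have hc : (‖(1 : ℝ) - 0‖₊ / 2) ^ 2 = 1 / 4 := by
      ext; norm_num
    rw [hc] at h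
    refine h.congr (ae_of_all _ fun z => ?_)
    simp [integral_indicator_const (1 : ℝ) hB]
  have hind : iIndepFun (fun i (S : Fin m → Z) =>
      D.real B - B.indicator (fun _ => (1 : ℝ)) (S i)) (iidSample D m) :=
    iIndepFun_pi (X := fun _ z => D.real B - B.indicator (fun _ => (1 : ℝ)) z)
      fun i => (measurable_const.sub hmeas).aemeasurable
  have h2 := HasSubgaussianMGF.sum_of_iIndepFun hind (c := fun _ => 1 / 4) (s := Finset.univ)
    fun i _ => by
      refine HasSubgaussianMGF.of_map (Y := fun S : Fin m → Z => S i)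
        (X := fun z => D.real B - B.indicator (fun _ => (1 : ℝ)) z)
        (measurable_pi_apply i).aemeasurable ?_
      rw [iidSample, (measurePreserving_eval (fun _ : Fin m => D) i).map_eq]
      exact h1
  convert h2 using 1
  simp [div_eq_mul_inv]

/-- Hoeffding's bound on the log-moment generating function is exactly the subtracted term. This
normalisation survives averaging over the prior. -/
lemma lintegral_exp_gap_le (D : Measure Z) [IsProbabilityMeasure D] {m : ℕ} (hm : 1 ≤ m)
    {B : Set Z} (hB : MeasurableSet B) (l : ℝ) :
    ∫⁻ S, ENNReal.ofReal (Real.exp (l * (D.real B - empiricalProb S B) - l ^ 2 / (8 * m)))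
      ∂iidSample D m ≤ 1 := by
  have hm0 : (m : ℝ) ≠ 0 := by positivity
  have h := hasSubgaussianMGF_sum_gap D m hB
  have heq : ∀ S : Fin m → Z, Real.exp (l * (D.real B - empiricalProb S B) - l ^ 2 / (8 * m))
      = Real.exp (-(l ^ 2 / (8 * m))) *
        Real.exp (l / m * ∑ i, (D.real B - B.indicator (fun _ => (1 : ℝ)) (S i))) := fun S => by
    rw [← Real.exp_add, Finset.sum_sub_distrib, empiricalProb]
    congr 1
    simp
    field_simp
    ring
  simp_rw [heq]
  rw [← ofReal_integral_eq_lintegral_ofReal ((h.integrable_exp_mul _).const_mul _)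
    (ae_of_all _ fun S => by positivity), integral_const_mul, ENNReal.ofReal_le_one]
  have h2 := h.mgf_le (l / m)
  rw [mgf] at h2
  calc _ ≤ Real.exp (-(l ^ 2 / (8 * m))) * Real.exp ((m / 4 : NNReal) * (l / m) ^ 2 / 2) := by
        gcongr
    _ = 1 := by
        rw [← Real.exp_add, Real.exp_eq_one_iff]
        push_cast
        field_simp
        ring

/-- Markov's inequality, as a high-probability statement. -/
lemma probAtLeast_lt_of_lintegral_le {Ω : Type*} [MeasurableSpace Ω] (μ : Measure Ω)
    [IsProbabilityMeasure μ] {F : Ω → ℝ≥0∞} (hF : Measurable F) {K δ : ℝ} (hK : 0 < K) (hδ : 0 < δ)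
    (h : ∫⁻ ω, F ω ∂μ ≤ ENNReal.ofReal K) :
    ProbAtLeast μ (1 - δ) {ω | F ω < ENNReal.ofReal (K / δ)} := by
  have hms : MeasurableSet {ω | F ω < ENNReal.ofReal (K / δ)} := measurableSet_lt hF measurable_const
  refine ⟨_, subset_rfl, hms, ?_⟩
  have hc : {ω | F ω < ENNReal.ofReal (K / δ)}ᶜ = {ω | ENNReal.ofReal (K / δ) ≤ F ω} := by
    ext; simp
  have h1 : μ.real {ω | ENNReal.ofReal (K / δ) ≤ F ω} ≤ δ := by
    refine ENNReal.toReal_le_of_le_ofReal hδ.le ?_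
    have h2 := meas_ge_le_lintegral_div (μ := μ) hF.aemeasurable
      (ENNReal.ofReal_pos.2 (div_pos hK hδ)).ne' ENNReal.ofReal_ne_top
    refine h2.trans (ENNReal.div_le_of_le_mul (h.trans ?_))
    rw [← ENNReal.ofReal_mul hδ.le]
    exact ENNReal.ofReal_le_ofReal (by field_simp; rfl)
  have h3 := probReal_compl_eq_one_sub (μ := μ) hms
  rw [hc] at h3
  linarith

lemma ProbAtLeast.mono {Ω : Type*} [MeasurableSpace Ω] {μ : Measure Ω} {p : ℝ} {E F : Set Ω}
    (h : ProbAtLeast μ p E) (hEF : E ⊆ F) : ProbAtLeast μ p F := by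
  obtain ⟨A, hA, hm, hp⟩ := h
  exact ⟨A, hA.trans hEF, hm, hp⟩

/-- Hoeffding's inequality. -/
lemma probAtLeast_hoeffding (D : Measure Z) [IsProbabilityMeasure D] {m : ℕ} (hm : 1 ≤ m)
    {B : Set Z} (hB : MeasurableSet B) {δ : ℝ} (hδ : 0 < δ) (hδ1 : δ < 1) :
    ProbAtLeast (iidSample D m) (1 - δ)
      {S | D.real B ≤ empiricalProb S B + √(Real.log δ⁻¹ / m)} := by
  have hm0 : (0 : ℝ) < m := by positivity
  have hL : 0 < Real.log δ⁻¹ := Real.log_pos (one_lt_inv_iff₀.2 ⟨hδ, hδ1⟩)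
  set s := √(Real.log δ⁻¹ / m) with hs
  have hs0 : 0 < s := Real.sqrt_pos.2 (by positivity)
  have hs2 : s ^ 2 * m = Real.log δ⁻¹ := by
    rw [hs, Real.sq_sqrt (by positivity)]; field_simp
  have hmeas : Measurable (B.indicator fun _ => (1 : ℝ)) := measurable_const.indicator hB
  have hemp : Measurable fun S : Fin m → Z => empiricalProb S B :=
    (Finset.measurable_sum _ fun i _ => hmeas.comp (measurable_pi_apply i)).div_const _
  -- The value `4 * m * s` maximises l s - l²/(8m) over l.
  refine (probAtLeast_lt_of_lintegral_le (iidSample D m) (by fun_prop) one_pos hδ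
    ((lintegral_exp_gap_le D hm hB (4 * m * s)).trans (by simp))).mono fun S hS => ?_
  simp only [Set.mem_ofPred_eq] at hS ⊢
  rw [ENNReal.ofReal_lt_ofReal_iff (by positivity), one_div,
    ← Real.lt_log_iff_exp_lt (by positivity), ← hs2] at hS
  by_contra! hcon
  have h1 : (4 * m * s) ^ 2 / (8 * m) = 2 * m * s ^ 2 := by field_simp; ring
  rw [h1] at hS
  nlinarith [mul_pos hm0 hs0, mul_pos (mul_pos hm0 hs0) hs0]

lemma integral_real_section_swap {V : Type*} [MeasurableSpace V] (P : Measure V)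
    (D : Measure Z) [IsProbabilityMeasure P] [IsProbabilityMeasure D] {B : Set (V × Z)}
    (hB : MeasurableSet B) :
    ∫ v, D.real {z | (v, z) ∈ B} ∂P = ∫ z, P.real {v | (v, z) ∈ B} ∂D := by
  have h1 : ∫ v, (D (Prod.mk v ⁻¹' B)).toReal ∂P = (∫⁻ v, D (Prod.mk v ⁻¹' B) ∂P).toReal :=
    integral_toReal (measurable_measure_prodMk_left hB).aemeasurable
      (ae_of_all _ fun v => measure_lt_top _ _)
  have h2 : ∫ z, (P ((fun v => (v, z)) ⁻¹' B)).toReal ∂D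
      = (∫⁻ z, P ((fun v => (v, z)) ⁻¹' B) ∂D).toReal :=
    integral_toReal (measurable_measure_prodMk_right hB).aemeasurable
      (ae_of_all _ fun v => measure_lt_top _ _)
  rw [← Measure.prod_apply hB] at h1
  rw [← Measure.prod_apply_symm hB] at h2
  exact h1.trans h2.symm

set_option maxHeartbeats 1000000 in
/-- A PAC-Bayes bound for Gaussian posteriors, uniform in the posterior mean `u` and in a grid of
inverse temperatures. -/
lemma probAtLeast_pacBayes {n : ℕ} (D : Measure Z) [IsProbabilityMeasure D] {m : ℕ} (hm : 1 ≤ m)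
    {B : Set (EuclideanSpace ℝ (Fin n) × Z)} (hB : MeasurableSet B) {δ : ℝ} (hδ : 0 < δ)
    (l : Fin m → ℝ) :
    ProbAtLeast (iidSample D m) (1 - δ)
      {S | ∀ (u : EuclideanSpace ℝ (Fin n)) (j : Fin m),
        l j * (∫ z, (prior n).real {v | (u + v, z) ∈ B} ∂D
            - (∑ i, (prior n).real {v | (u + v, S i) ∈ B}) / m)
          ≤ ‖u‖ ^ 2 / 2 + Real.log (m / δ) + l j ^ 2 / (8 * m)} := by
  have hm0 : (0 : ℝ) < m := by positivity
  have hsec : ∀ v, MeasurableSet {z | (v, z) ∈ B} := fun v => measurable_prodMk_left hB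
  have hDm : Measurable fun v => D.real {z | (v, z) ∈ B} :=
    (measurable_measure_prodMk_left hB).ennreal_toReal
  have hemp : Measurable fun p : (Fin m → Z) × EuclideanSpace ℝ (Fin n) =>
      empiricalProb p.1 {z | (p.2, z) ∈ B} := by
    have h1 : Measurable (B.indicator fun _ => (1 : ℝ)) := measurable_const.indicator hB
    have h2 : ∀ i : Fin m, Measurable fun p : (Fin m → Z) × EuclideanSpace ℝ (Fin n) =>
        B.indicator (fun _ => (1 : ℝ)) (p.2, p.1 i) := fun i => h1.comp (by fun_prop)
    exact (Finset.measurable_sum _ fun i _ => h2 i).div_const _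
  set G : Fin m → (Fin m → Z) → EuclideanSpace ℝ (Fin n) → ℝ := fun j S v =>
    l j * (D.real {z | (v, z) ∈ B} - empiricalProb S {z | (v, z) ∈ B}) - l j ^ 2 / (8 * m) with hG
  have hGm : ∀ j, Measurable fun p : (Fin m → Z) × EuclideanSpace ℝ (Fin n) => G j p.1 p.2 :=
    fun j => ((measurable_const.mul ((hDm.comp measurable_snd).sub hemp)).sub measurable_const)
  have hGS : ∀ j S, Measurable (G j S) := fun j S => (hGm j).comp measurable_prodMk_left
  -- Summing over the grid replaces a union bound: the mean is at most `m`, and Markov's inequality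
  -- at level `m / δ` controls every temperature at once.
  set F : (Fin m → Z) → ℝ≥0∞ := fun S =>
    ∑ j, ∫⁻ v, ENNReal.ofReal (Real.exp (G j S v)) ∂prior n with hF
  have hFj : ∀ j, Measurable fun S => ∫⁻ v, ENNReal.ofReal (Real.exp (G j S v)) ∂prior n :=
    fun j => Measurable.lintegral_prod_right'
      (f := fun p : (Fin m → Z) × EuclideanSpace ℝ (Fin n) =>
        ENNReal.ofReal (Real.exp (G j p.1 p.2)))
      (ENNReal.measurable_ofReal.comp (Real.measurable_exp.comp (hGm j)))
  have hFint : ∫⁻ S, F S ∂iidSample D m ≤ ENNReal.ofReal m := by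
    rw [hF, lintegral_finsetSum _ fun j _ => hFj j]
    calc _ ≤ ∑ _j : Fin m, (1 : ℝ≥0∞) := by
          refine Finset.sum_le_sum fun j _ => ?_
          -- The prior does not depend on the sample, so the sample can be integrated out first, for
          -- fixed weights.
          rw [lintegral_lintegral_swap (f := fun S v => ENNReal.ofReal (Real.exp (G j S v))) (ENNReal.measurable_ofReal.comp
            (Real.measurable_exp.comp (hGm j))).aemeasurable]
          calc _ ≤ ∫⁻ _v, 1 ∂prior n :=
                lintegral_mono fun v => lintegral_exp_gap_le D hm (hsec v) (l j)
            _ = 1 := by simp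
      _ = ENNReal.ofReal m := by simp
  refine (probAtLeast_lt_of_lintegral_le _ (Finset.measurable_sum _ fun j _ => hFj j) hm0 hδ
    hFint).mono fun S hS u j => ?_
  simp only [Set.mem_ofPred_eq] at hS
  have hbound : ∀ v, |G j S v| ≤ |l j| + |l j ^ 2 / (8 * m)| := fun v => by
    refine (abs_sub _ _).trans (add_le_add ?_ le_rfl)
    rw [abs_mul]
    refine mul_le_of_le_one_right (abs_nonneg _) (abs_le.2 ⟨?_, ?_⟩)
    · linarith [empiricalProb_le_one S {z | (v, z) ∈ B},
        measureReal_nonneg (μ := D) (s := {z | (v, z) ∈ B})]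
    · linarith [empiricalProb_nonneg S {z | (v, z) ∈ B},
        measureReal_le_one (μ := D) (s := {z | (v, z) ∈ B})]
  have h1 := ((exp_integral_posterior_le u (hGS j S) hbound).trans
    (Finset.single_le_sum (f := fun j => ∫⁻ v, ENNReal.ofReal (Real.exp (G j S v)) ∂prior n)
      (fun _ _ => zero_le) (Finset.mem_univ j))).trans_lt hS
  rw [ENNReal.ofReal_lt_ofReal_iff (by positivity),
    ← Real.lt_log_iff_exp_lt (by positivity)] at h1
  have hshift : Measurable fun v : EuclideanSpace ℝ (Fin n) => u + v := by fun_prop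
  have hDi : Integrable (fun v => D.real {z | (u + v, z) ∈ B}) (prior n) :=
    Integrable.of_bound (hDm.comp hshift).aestronglyMeasurable 1
      (ae_of_all _ fun v => by
        rw [Real.norm_eq_abs, abs_of_nonneg measureReal_nonneg]; exact measureReal_le_one)
  have hBu : MeasurableSet {p : EuclideanSpace ℝ (Fin n) × Z | (u + p.1, p.2) ∈ B} :=
    hB.preimage (f := fun p : EuclideanSpace ℝ (Fin n) × Z => (u + p.1, p.2)) (by fun_prop)
  have hBz : ∀ z, MeasurableSet {v | (u + v, z) ∈ B} := fun z =>
    measurable_prodMk_right hBu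
  have hind : ∀ z, Integrable (fun v => B.indicator (fun _ => (1 : ℝ)) (u + v, z)) (prior n) :=
    fun z => (integrable_const (1 : ℝ)).indicator (hBz z)
  have hDint : ∫ v, D.real {z | (u + v, z) ∈ B} ∂prior n
      = ∫ z, (prior n).real {v | (u + v, z) ∈ B} ∂D :=
    integral_real_section_swap (prior n) D hBu
  have hEi : Integrable (fun v => empiricalProb S {z | (u + v, z) ∈ B}) (prior n) :=
    (integrable_finsetSum _ fun i _ => hind (S i)).div_const _
  have hEint : ∫ v, empiricalProb S {z | (u + v, z) ∈ B} ∂prior n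
      = (∑ i, (prior n).real {v | (u + v, S i) ∈ B}) / m := by
    have h3 : ∀ i, ∫ v, B.indicator (fun _ => (1 : ℝ)) (u + v, S i) ∂prior n
        = (prior n).real {v | (u + v, S i) ∈ B} := fun i => by
      have := integral_indicator_const (μ := prior n) (1 : ℝ) (hBz (S i))
      rw [smul_eq_mul, mul_one] at this
      exact this
    simp_rw [← h3]
    rw [← integral_finsetSum _ fun i _ => hind (S i), ← integral_div]
    rfl
  have hint : ∫ v, G j S (u + v) ∂prior n
      = l j * (∫ z, (prior n).real {v | (u + v, z) ∈ B} ∂D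
        - (∑ i, (prior n).real {v | (u + v, S i) ∈ B}) / m) - l j ^ 2 / (8 * m) := by
    rw [← hDint, ← hEint, ← integral_sub hDi hEi, ← integral_const_mul,
      integral_sub (f := fun v => l j * (D.real {z | (u + v, z) ∈ B}
        - empiricalProb S {z | (u + v, z) ∈ B})) ((hDi.sub hEi).const_mul _) (integrable_const _)]
    simp
  rw [hint] at h1
  linarith

end MarginBound

/-! ### Margins and their behaviour under Gaussian perturbation. -/

namespace MarginBound

section Margin

lemma margin_le {Y : Type*} [Finite Y] (f : Y → ℝ) {y y' : Y} (h : y' ≠ y) : margin f y ≤ f y - f y' :=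
  sub_le_sub_left (le_ciSup (f := fun y' : {y' : Y // y' ≠ y} => f y')
    (Set.finite_range _).bddAbove ⟨y', h⟩) _

variable {Y : Type*} [Fintype Y] [Nontrivial Y]

lemma exists_margin_eq (f : Y → ℝ) (y : Y) : ∃ y' ≠ y, margin f y = f y - f y' := by
  have : Nonempty {y' : Y // y' ≠ y} := nonempty_subtype.2 (exists_ne y)
  obtain ⟨⟨y', hy'⟩, h⟩ := exists_eq_ciSup_of_finite (f := fun y' : {y' : Y // y' ≠ y} => f y')
  exact ⟨y', hy', by rw [margin, ← h]⟩

lemma margin_le_iff (f : Y → ℝ) (y : Y) (θ : ℝ) :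
    margin f y ≤ θ ↔ ∃ y' ≠ y, f y - f y' ≤ θ := by
  constructor
  · intro h
    obtain ⟨y', hy', he⟩ := exists_margin_eq f y
    exact ⟨y', hy', he ▸ h⟩
  · rintro ⟨y', hy', h⟩
    exact (margin_le f hy').trans h

lemma abs_margin_le (f : Y → ℝ) (y : Y) : |margin f y| ≤ |f y| + ∑ y', |f y'| := by
  obtain ⟨y', -, he⟩ := exists_margin_eq f y
  rw [he]
  exact (abs_sub _ _).trans (by
    gcongr
    exact Finset.single_le_sum (f := fun y' => |f y'|) (fun _ _ => abs_nonneg _)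
      (Finset.mem_univ y'))

end Margin

lemma score_sub {X Y : Type*} {n : ℕ} (φ : X → Y → EuclideanSpace ℝ (Fin n)) (w : EuclideanSpace ℝ (Fin n)) (x : X)
    (y y' : Y) : score φ w x y - score φ w x y' = inner ℝ (φ x y - φ x y') w := by
  rw [score, score, ← inner_sub_right, real_inner_comm]

variable {X Y : Type*} [Fintype Y] [Nontrivial Y] {n : ℕ}
  {φ : X → Y → EuclideanSpace ℝ (Fin n)}

lemma setOf_ne_subset_margin {w : EuclideanSpace ℝ (Fin n)} {h : X → Y}
    (hh : IsArgmaxPredictor (score φ w) h) :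
    {z : X × Y | h z.1 ≠ z.2} ⊆ {z | margin (score φ w z.1) z.2 ≤ 0} := fun z hz =>
  (margin_le_iff _ _ _).2 ⟨h z.1, hz, sub_nonpos.2 (hh z.1 z.2)⟩

lemma margin_score_le (w : EuclideanSpace ℝ (Fin n)) {R : ℝ} (hφ : ∀ x y, ‖φ x y‖ ≤ R)
    (x : X) (y : Y) : margin (score φ w x) y ≤ 2 * R * ‖w‖ := by
  obtain ⟨y', -, he⟩ := exists_margin_eq (score φ w x) y
  rw [he, score_sub]
  refine (real_inner_le_norm _ _).trans ?_
  gcongr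
  linarith [norm_sub_le (φ x y) (φ x y'), hφ x y, hφ x y']

section Measurability

variable [MeasurableSpace X] [MeasurableSpace Y] [MeasurableSingletonClass Y]

/-- The supremum in the margin runs over an index set depending on the label; a finite union over
competitors avoids this dependence. -/
lemma measurableSet_margin_le (hφ : ∀ y, Measurable fun x => φ x y) (θ : ℝ) :
    MeasurableSet {p : EuclideanSpace ℝ (Fin n) × (X × Y) |
      margin (score φ p.1 p.2.1) p.2.2 ≤ θ} := by
  have hφ' : Measurable fun z : X × Y => φ z.1 z.2 :=
    measurable_from_prod_countable_left fun y => hφ y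
  have h : {p : EuclideanSpace ℝ (Fin n) × (X × Y) | margin (score φ p.1 p.2.1) p.2.2 ≤ θ}
      = ⋃ y', {p | p.2.2 ∈ ({y'}ᶜ : Set Y)} ∩
        {p | score φ p.1 p.2.1 p.2.2 - score φ p.1 p.2.1 y' ≤ θ} := by
    ext p
    simp [margin_le_iff, eq_comm]
  rw [h]
  refine MeasurableSet.iUnion fun y' => ?_
  refine ((measurableSet_singleton y').compl.preimage
    (measurable_snd.comp measurable_snd)).inter (measurableSet_le ?_ measurable_const)
  have h1 : Measurable fun p : EuclideanSpace ℝ (Fin n) × (X × Y) => φ p.2.1 p.2.2 :=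
    hφ'.comp measurable_snd
  have h2 : Measurable fun p : EuclideanSpace ℝ (Fin n) × (X × Y) => φ p.2.1 y' :=
    (hφ y').comp (measurable_fst.comp measurable_snd)
  exact (measurable_fst.inner h1).sub (measurable_fst.inner h2)

end Measurability

lemma measurable_margin_score (z : X × Y) :
    Measurable fun w : EuclideanSpace ℝ (Fin n) => margin (score φ w z.1) z.2 := by
  -- With `z` fixed only the weights vary, so discrete σ-algebras make the measurability of `φ`
  -- automatic.
  let _ : MeasurableSpace X := ⊤
  let _ : MeasurableSpace Y := ⊤
  exact measurable_of_Iic fun θ =>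
    measurable_prodMk_right (y := z) (measurableSet_margin_le (φ := φ)
      (fun y => measurable_from_top) θ)

/-- The competitor attaining the margin at `w` bounds the margin at every `w + v`, up to a linear
form in `v` of mean zero. -/
lemma expectedMargin_le_margin (w : EuclideanSpace ℝ (Fin n)) (z : X × Y) :
    expectedMargin φ w z ≤ margin (score φ w z.1) z.2 := by
  obtain ⟨y', hy', he⟩ := exists_margin_eq (score φ w z.1) z.2
  have hm := measurable_margin_score (φ := φ) z
  have hlin : ∀ u : EuclideanSpace ℝ (Fin n),
      Integrable (fun v => (inner ℝ u v : ℝ)) (prior n) := fun u =>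
    (hasSubgaussianMGF_inner_prior u (‖u‖₊ ^ 2) (by simp)).integrable
  have hsc : ∀ y, Integrable (fun v => score φ (w + v) z.1 y) (prior n) := fun y => by
    have h := (integrable_const (μ := prior n) (inner ℝ w (φ z.1 y) : ℝ)).add (hlin (φ z.1 y))
    refine h.congr (ae_of_all _ fun v => ?_)
    simp [score, inner_add_left, real_inner_comm]
  have hint : Integrable (fun v => margin (score φ (w + v) z.1) z.2) (prior n) :=
    ((hsc z.2).abs.add (integrable_finsetSum _ fun y _ => (hsc y).abs)).mono'
      (hm.comp (measurable_const_add w)).aestronglyMeasurable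
      (ae_of_all _ fun v => by simpa using abs_margin_le (score φ (w + v) z.1) z.2)
  have h0 : ∫ v, (inner ℝ (φ z.1 z.2 - φ z.1 y') v : ℝ) ∂prior n = 0 :=
    integral_strongDual_stdGaussian (innerSL ℝ _)
  rw [expectedMargin, posterior, integral_map (by fun_prop) hm.aestronglyMeasurable]
  calc ∫ v, margin (score φ (w + v) z.1) z.2 ∂prior n
      ≤ ∫ v, (margin (score φ w z.1) z.2 + inner ℝ (φ z.1 z.2 - φ z.1 y') v) ∂prior n := by
        refine integral_mono hint ((integrable_const _).add (hlin _)) fun v => ?_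
        refine (margin_le _ hy').trans (le_of_eq ?_)
        rw [he, score_sub, score_sub, inner_add_right]
    _ = margin (score φ w z.1) z.2 := by
        rw [integral_add (integrable_const _) (hlin _), h0]
        simp

variable {w : EuclideanSpace ℝ (Fin n)} {R t θ γ : ℝ}

/-- A Gaussian perturbation of a model rarely gives a large margin to an observation on which the
model errs. -/
lemma one_sub_le_prior_margin_le (hφ : ∀ x y, ‖φ x y‖ ≤ R) (ht : 0 ≤ t) (hθ : 0 ≤ θ) {x : X} {y : Y}
    (hw : margin (score φ w x) y ≤ 0) :
    1 - Real.exp (-θ ^ 2 / (8 * R ^ 2))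
      ≤ (prior n).real {v | margin (score φ (t • w + v) x) y ≤ θ} := by
  obtain ⟨y', hy', he⟩ := exists_margin_eq (score φ w x) y
  rw [he, score_sub] at hw
  have hms : MeasurableSet {v | margin (score φ (t • w + v) x) y ≤ θ} :=
    measurableSet_le ((measurable_margin_score (x, y)).comp (measurable_const_add (t • w)))
      measurable_const
  have h1 := prior_inner_ge_le (φ x y - φ x y') (r := 2 * R) (s := θ)
    (by linarith [norm_sub_le (φ x y) (φ x y'), hφ x y, hφ x y']) hθ
  have h2 : (prior n).real {v | margin (score φ (t • w + v) x) y ≤ θ}ᶜ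
      ≤ (prior n).real {v | θ ≤ inner ℝ (φ x y - φ x y') v} := by
    refine measureReal_mono fun v hv => ?_
    simp only [Set.mem_compl_iff, Set.mem_ofPred_eq, not_le] at hv ⊢
    have h3 := hv.trans_le (margin_le _ hy')
    rw [score_sub, inner_add_right, real_inner_smul_right] at h3
    linarith [mul_nonpos_of_nonneg_of_nonpos ht hw]
  rw [probReal_compl_eq_one_sub hms] at h2
  rw [show 2 * (2 * R) ^ 2 = 8 * R ^ 2 by ring] at h1
  linarith

/-- A Gaussian perturbation of a model rarely gives a small margin to an observation on which the
model has a large margin. -/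
lemma prior_margin_le_le (hφ : ∀ x y, ‖φ x y‖ ≤ R) (ht : 0 ≤ t) (hθ : 0 ≤ θ) (htγ : t * γ = 2 * θ)
    {x : X} {y : Y} (hw : γ < margin (score φ w x) y) :
    (prior n).real {v | margin (score φ (t • w + v) x) y ≤ θ}
      ≤ Fintype.card Y * Real.exp (-θ ^ 2 / (8 * R ^ 2)) := by
  -- As `t * γ = 2 * θ`, the scaled margin exceeds `2 * θ`; dropping to `θ` takes noise of at least
  -- `θ` in favour of some label.
  have h1 : {v | margin (score φ (t • w + v) x) y ≤ θ}
      ⊆ ⋃ y', {v | θ ≤ inner ℝ (φ x y' - φ x y) v} := fun v hv => by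
    obtain ⟨y', hy', h⟩ := (margin_le_iff _ _ _).1 hv
    refine Set.mem_iUnion.2 ⟨y', ?_⟩
    have h2 := hw.trans_le (margin_le _ hy')
    rw [score_sub] at h h2
    rw [inner_add_right, real_inner_smul_right] at h
    have h3 := mul_le_mul_of_nonneg_left h2.le ht
    rw [Set.mem_ofPred_eq, ← neg_sub, inner_neg_left]
    linarith
  calc _ ≤ (prior n).real (⋃ y', {v | θ ≤ inner ℝ (φ x y' - φ x y) v}) := measureReal_mono h1
    _ ≤ ∑ y', (prior n).real {v | θ ≤ inner ℝ (φ x y' - φ x y) v} :=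
        measureReal_iUnion_fintype_le _
    _ ≤ ∑ _y' : Y, Real.exp (-θ ^ 2 / (8 * R ^ 2)) := by
        refine Finset.sum_le_sum fun y' _ => ?_
        rw [show 8 * R ^ 2 = 2 * (2 * R) ^ 2 by ring]
        exact prior_inner_ge_le _
          (by linarith [norm_sub_le (φ x y') (φ x y), hφ x y, hφ x y']) hθ
    _ = _ := by simp

lemma mean_margin_le_le {ε : ℝ} {m : ℕ} (hm : 1 ≤ m)
    (S : Fin m → X × Y) (hφ : ∀ x y, ‖φ x y‖ ≤ R) (ht : 0 ≤ t) (hθ : 0 ≤ θ) (htγ : t * γ = 2 * θ)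
    (hε : Fintype.card Y * Real.exp (-θ ^ 2 / (8 * R ^ 2)) ≤ ε) :
    (∑ i, (prior n).real {v | margin (score φ (t • w + v) (S i).1) (S i).2 ≤ θ}) / m
      ≤ empiricalProb S {z | margin (score φ w z.1) z.2 ≤ γ} + ε := by
  have hm0 : (m : ℝ) ≠ 0 := by positivity
  have hε0 : 0 ≤ ε := (by positivity : (0 : ℝ) ≤ _).trans hε
  rw [show empiricalProb S {z | margin (score φ w z.1) z.2 ≤ γ} + ε
      = (∑ i, ({z | margin (score φ w z.1) z.2 ≤ γ}.indicator (fun _ => (1 : ℝ)) (S i) + ε)) / m by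
    rw [Finset.sum_add_distrib, add_div, empiricalProb]
    simp [hm0]]
  gcongr with i
  by_cases hz : S i ∈ {z : X × Y | margin (score φ w z.1) z.2 ≤ γ}
  · rw [Set.indicator_of_mem hz]
    linarith [measureReal_le_one (μ := prior n)
      (s := {v | margin (score φ (t • w + v) (S i).1) (S i).2 ≤ θ})]
  · rw [Set.indicator_of_notMem hz, zero_add]
    exact (prior_margin_le_le hφ ht hθ htγ (not_le.1 hz)).trans hε

lemma misclassificationError_le_margin [MeasurableSpace X] [MeasurableSpace Y] {h : X → Y}
    (D : Measure (X × Y)) [IsProbabilityMeasure D] (hh : IsArgmaxPredictor (score φ w) h) :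
    misclassificationError D h ≤ D.real {z | margin (score φ w z.1) z.2 ≤ 0} :=
  measureReal_mono (setOf_ne_subset_margin hh)

end MarginBound

/-! ### Tuning the parameters and assembling the uniform bound. -/

namespace MarginBound

lemma sqrt_log_le_rate {n : ℕ} (w : EuclideanSpace ℝ (Fin n)) {c α γ δ : ℝ} {m k : ℕ} (hc : 0 < c)
    (hα : α < 1) (hm : 1 ≤ m) (hk : 1 ≤ k) :
    √(Real.log δ⁻¹ / m) ≤ rate c α γ δ m k w := by
  have hmk : (1 : ℝ) ≤ m * k := by exact_mod_cast Nat.mul_pos hm hk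
  have h1 := Real.log_nonneg hmk
  have h2 := Real.log_nonneg (show (1 : ℝ) ≤ m by exact_mod_cast hm)
  have h3 : 0 < 1 - α := by linarith
  refine Real.sqrt_le_sqrt ?_
  gcongr
  have : 0 ≤ ‖w‖ ^ 2 / (2 * c * (1 - α) * γ ^ 2) * Real.log (m * k) := by positivity
  linarith

lemma sqrt_le_rate {n : ℕ} (w : EuclideanSpace ℝ (Fin n)) {R α γ δ : ℝ} {m k : ℕ} (hR : 0 < R)
    (hγ : 0 < γ) (hα0 : 0 ≤ α) (hα : α < 1) (hm : 1 ≤ m) (hk : 1 ≤ k) :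
    √((16 * (R * ‖w‖ / γ) ^ 2 * Real.log (m * k) + Real.log m + Real.log δ⁻¹) / m)
      ≤ rate (1 / 32 / R ^ 2) α γ δ m k w := by
  have hmk : (1 : ℝ) ≤ m * k := by exact_mod_cast Nat.mul_pos hm hk
  have h1 := Real.log_nonneg hmk
  have h3 : 0 < 1 - α := by linarith
  refine Real.sqrt_le_sqrt ?_
  gcongr
  -- The constant 1/32 is what turns 1/(2c) into 16; the factor 1/(1 - α) ≥ 1 only weakens the
  -- bound.
  have h4 : ‖w‖ ^ 2 / (2 * (1 / 32 / R ^ 2) * (1 - α) * γ ^ 2)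
      = 16 * (R * ‖w‖ / γ) ^ 2 / (1 - α) := by
    field_simp
    ring
  rw [h4]
  exact le_div_self (by positivity) h3 (by linarith)

/-- Choice of the inverse temperature `√(m j)` in a grid, with `j = ⌈A⌉`. -/
lemma gap_add_le_of_grid {m : ℕ} {A g : ℝ} (hA : 1 ≤ A) (hAm : A < m)
    (h : ∀ j : Fin m, √(m * (j + 1)) * g ≤ A + √(m * (j + 1)) ^ 2 / (8 * m)) :
    g + 2 / m ≤ 4 * √(A / m) := by
  have hm : (0 : ℝ) < m := by linarith
  have hj1 : 1 ≤ ⌈A⌉₊ := Nat.one_le_ceil_iff.2 (by linarith)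
  have hjm : ⌈A⌉₊ ≤ m := Nat.ceil_le.2 hAm.le
  -- Grid indices start at 0, so `⌈A⌉₊` sits at index `⌈A⌉₊ - 1`. The terms below add up to s + s/4
  -- + 2s ≤ 4s.
  have hj := h ⟨⌈A⌉₊ - 1, by omega⟩
  simp only [Nat.cast_sub hj1, Nat.cast_one, sub_add_cancel] at hj
  have hc1 : A ≤ ⌈A⌉₊ := Nat.le_ceil A
  have hc2 : (⌈A⌉₊ : ℝ) < A + 1 := Nat.ceil_lt_add_one (by linarith)
  set l := √(m * (⌈A⌉₊ : ℝ)) with hl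
  set s := √(A / m) with hs
  have hs0 : 0 < s := Real.sqrt_pos.2 (by positivity)
  have hs2 : s ^ 2 * m = A := by rw [hs, Real.sq_sqrt (by positivity)]; field_simp
  have hl2 : l ^ 2 = m * ⌈A⌉₊ := Real.sq_sqrt (by positivity)
  have hl0 : 0 < l := Real.sqrt_pos.2 (by positivity)
  have hls : m * s ≤ l := by
    refine abs_le_of_sq_le_sq' ?_ hl0.le |>.2
    rw [hl2, mul_pow]
    nlinarith
  have hls' : l ≤ 2 * (m * s) := by
    refine abs_le_of_sq_le_sq' ?_ (by positivity) |>.2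
    rw [hl2]
    nlinarith
  have hms : 1 ≤ m * s := by
    refine abs_le_of_sq_le_sq' ?_ (by positivity) |>.2
    nlinarith
  have hg : g ≤ A / l + l / (8 * m) := by
    rw [show A / l + l / (8 * m) = (A + l ^ 2 / (8 * m)) / l by field_simp, le_div_iff₀ hl0]
    linarith
  have h1 : A / l ≤ s := by
    rw [div_le_iff₀ hl0]
    nlinarith
  have h2 : l / (8 * m) ≤ s / 4 := by
    rw [div_le_iff₀ (by positivity)]
    linarith
  have h3 : 2 / (m : ℝ) ≤ 2 * s := by
    rw [div_le_iff₀ hm]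
    linarith
  linarith

variable {X Y : Type*} [MeasurableSpace X] [Fintype Y] [Nontrivial Y] [MeasurableSpace Y]
  [MeasurableSingletonClass Y] {n : ℕ} {φ : X → Y → EuclideanSpace ℝ (Fin n)}

/-- Integrates `one_sub_le_prior_margin_le` over the data: the indicator of an error is at most the
perturbed loss plus `ε`. -/
lemma measureReal_margin_le_add {w : EuclideanSpace ℝ (Fin n)} {R t θ ε : ℝ}
    (hφm : ∀ y, Measurable fun x => φ x y) (D : Measure (X × Y)) [IsProbabilityMeasure D]
    (hφ : ∀ x y, ‖φ x y‖ ≤ R) (ht : 0 ≤ t) (hθ : 0 ≤ θ)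
    (hε : Real.exp (-θ ^ 2 / (8 * R ^ 2)) ≤ ε) :
    D.real {z | margin (score φ w z.1) z.2 ≤ 0}
      ≤ ∫ z, (prior n).real {v | margin (score φ (t • w + v) z.1) z.2 ≤ θ} ∂D + ε := by
  have hε0 : 0 ≤ ε := (Real.exp_pos _).le.trans hε
  have hA : MeasurableSet {z : X × Y | margin (score φ w z.1) z.2 ≤ 0} :=
    measurable_prodMk_left (x := w) (measurableSet_margin_le hφm 0)
  have hB : MeasurableSet {p : EuclideanSpace ℝ (Fin n) × (X × Y) |
      margin (score φ (t • w + p.1) p.2.1) p.2.2 ≤ θ} :=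
    (measurableSet_margin_le hφm θ).preimage
      (f := fun p : EuclideanSpace ℝ (Fin n) × (X × Y) => (t • w + p.1, p.2)) (by fun_prop)
  have hq : Integrable (fun z : X × Y =>
      (prior n).real {v | margin (score φ (t • w + v) z.1) z.2 ≤ θ}) D :=
    Integrable.of_bound (measurable_measure_prodMk_right hB).ennreal_toReal.aestronglyMeasurable 1
      (ae_of_all _ fun z => by
        rw [Real.norm_eq_abs, abs_of_nonneg measureReal_nonneg]; exact measureReal_le_one)
  have h1 := integral_indicator_const (μ := D) (1 : ℝ) hA
  rw [smul_eq_mul, mul_one] at h1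
  have h2 : ∫ z, ((prior n).real {v | margin (score φ (t • w + v) z.1) z.2 ≤ θ} + ε) ∂D
      = ∫ z, (prior n).real {v | margin (score φ (t • w + v) z.1) z.2 ≤ θ} ∂D + ε := by
    rw [integral_add hq (integrable_const _)]
    simp
  rw [← h1, ← h2]
  refine integral_mono ((integrable_const _).indicator hA) (hq.add (integrable_const _)) fun z => ?_
  by_cases hz : z ∈ {z : X × Y | margin (score φ w z.1) z.2 ≤ 0}
  · rw [Set.indicator_of_mem hz]
    have h3 := one_sub_le_prior_margin_le (t := t) hφ ht hθ hz
    linarith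
  · rw [Set.indicator_of_notMem hz]
    exact add_nonneg measureReal_nonneg hε0

lemma probAtLeast_of_one_le {Ω : Type*} [MeasurableSpace Ω] (μ : Measure Ω) {δ : ℝ} (hδ : 1 ≤ δ)
    (E : Set Ω) : ProbAtLeast μ (1 - δ) E :=
  ⟨∅, Set.empty_subset _, MeasurableSet.empty, by simp [hδ]⟩

lemma margin_bound_of_pacBayes {m : ℕ} (hm : 1 ≤ m) (hφm : ∀ y, Measurable fun x => φ x y)
    (D : Measure (X × Y)) [IsProbabilityMeasure D] {R γ δ θ : ℝ} (hR : 0 < R) (hγ : 0 < γ)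
    (hδ : 0 < δ) (hδ1 : δ ≤ 1) (hφ : ∀ x y, ‖φ x y‖ ≤ R) (hθ : 0 ≤ θ)
    (hθ2 : θ ^ 2 = 8 * R ^ 2 * Real.log (m * Fintype.card Y)) (S : Fin m → X × Y)
    (hS : ∀ (u : EuclideanSpace ℝ (Fin n)) (j : Fin m),
      √(m * (j + 1)) * (∫ z, (prior n).real {v | margin (score φ (u + v) z.1) z.2 ≤ θ} ∂D
          - (∑ i, (prior n).real {v | margin (score φ (u + v) (S i).1) (S i).2 ≤ θ}) / m)
        ≤ ‖u‖ ^ 2 / 2 + Real.log (m / δ) + √(m * (j + 1)) ^ 2 / (8 * m))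
    (w : EuclideanSpace ℝ (Fin n)) :
    D.real {z | margin (score φ w z.1) z.2 ≤ 0}
      ≤ empiricalProb S {z | margin (score φ w z.1) z.2 ≤ γ}
        + 4 * √((16 * (R * ‖w‖ / γ) ^ 2 * Real.log (m * Fintype.card Y) + Real.log m
          + Real.log δ⁻¹) / m) := by
  have hm0 : (0 : ℝ) < m := by positivity
  have hm1 : (1 : ℝ) ≤ m := by exact_mod_cast hm
  have hk : (2 : ℝ) ≤ Fintype.card Y := by exact_mod_cast Fintype.one_lt_card (α := Y)
  have hk0 : (0 : ℝ) < Fintype.card Y := by linarith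
  have hlogmk : Real.log 2 ≤ Real.log (m * Fintype.card Y) :=
    Real.log_le_log two_pos (by nlinarith)
  have hlogm := Real.log_nonneg hm1
  have hlogδ : 0 ≤ Real.log δ⁻¹ := Real.log_nonneg ((one_le_inv₀ hδ).2 hδ1)
  have hlog2 := Real.log_two_gt_d9
  -- If 2R‖w‖ ≤ γ, no margin exceeds `γ` and the empirical term is 1. Otherwise A ≥ 4 ln 2 ≥ 1, as
  -- the grid requires.
  rcases le_or_gt (2 * (R * ‖w‖ / γ)) 1 with hT | hT
  · have hall : {z : X × Y | margin (score φ w z.1) z.2 ≤ γ} = Set.univ := by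
      refine Set.eq_univ_of_forall fun z => (margin_score_le w hφ z.1 z.2).trans ?_
      rw [← mul_div_assoc, div_le_one hγ] at hT
      linarith
    rw [hall, empiricalProb_univ hm]
    linarith [measureReal_le_one (μ := D) (s := {z | margin (score φ w z.1) z.2 ≤ 0}),
      Real.sqrt_nonneg ((16 * (R * ‖w‖ / γ) ^ 2 * Real.log (m * Fintype.card Y) + Real.log m
          + Real.log δ⁻¹) / m)]
  set A := 16 * (R * ‖w‖ / γ) ^ 2 * Real.log (m * Fintype.card Y) + Real.log m + Real.log δ⁻¹
    with hA
  have hA1 : 1 ≤ A := by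
    have h1 : 1 ≤ 4 * (R * ‖w‖ / γ) ^ 2 := by nlinarith
    nlinarith
  -- Beyond the range of the grid the deviation term alone exceeds 1.
  rcases le_or_gt (m : ℝ) A with hAm | hAm
  · have h1 : 1 ≤ √(A / m) := by
      rw [Real.one_le_sqrt, one_le_div hm0]
      exact hAm
    linarith [measureReal_le_one (μ := D) (s := {z | margin (score φ w z.1) z.2 ≤ 0}),
      empiricalProb_nonneg S {z | margin (score φ w z.1) z.2 ≤ γ}]
  have hexp : Real.exp (-θ ^ 2 / (8 * R ^ 2)) = 1 / (m * Fintype.card Y) := by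
    rw [hθ2, neg_div, mul_div_cancel_left₀ _ (by positivity), Real.exp_neg,
      Real.exp_log (by positivity), one_div]
  have ht : 0 ≤ 2 * θ / γ := by positivity
  have h1 := measureReal_margin_le_add (w := w) (t := 2 * θ / γ) (ε := 1 / m) hφm D hφ ht hθ (by
    rw [hexp]
    exact one_div_le_one_div_of_le hm0 (by nlinarith))
  have h2 := mean_margin_le_le (w := w) (t := 2 * θ / γ) (γ := γ) (ε := 1 / m) hm S hφ ht hθ
    (by field_simp) (by rw [hexp]; exact le_of_eq (by field_simp))
  -- The `2 / m` in the conclusion absorbs both approximation errors `1 / m`; `A` is the relative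
  -- entropy plus ln(m/δ).
  have h3 := gap_add_le_of_grid hA1 hAm fun j => by
    refine (hS ((2 * θ / γ) • w) j).trans (le_of_eq ?_)
    rw [norm_smul, Real.norm_eq_abs, abs_of_nonneg ht, div_eq_mul_inv (m : ℝ) δ,
      Real.log_mul hm0.ne' (inv_pos.2 hδ).ne', hA,
      show (2 * θ / γ * ‖w‖) ^ 2 / 2 = 2 * θ ^ 2 * (‖w‖ / γ) ^ 2 by ring, hθ2]
    ring
  have h4 : 2 / (m : ℝ) = 1 / m + 1 / m := by ring
  linarith

end MarginBound

open MarginBound in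
theorem theorem3 :
    ∃ C c : ℝ, 0 < C ∧ 0 < c ∧
      ∀ (X Y : Type*) [MeasurableSpace X]
        [Fintype Y] [Nontrivial Y] [MeasurableSpace Y] [MeasurableSingletonClass Y]
        (n : ℕ) (φ : X → Y → EuclideanSpace ℝ (Fin n)) (_ : ∀ y, Measurable fun x => φ x y)
        (D : Measure (X × Y)) [IsProbabilityMeasure D]
        (m : ℕ) (_ : 1 ≤ m)
        (δ : ℝ) (_ : 0 < δ) (_ : δ ≤ 1) (γ : ℝ) (_ : 0 < γ) (α : ℝ) (_ : 0 ≤ α) (_ : α < 1),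
        -- a fixed weight vector, arbitrary features, absolute constants
        (∀ w : EuclideanSpace ℝ (Fin n),
          MarginBound.ProbAtLeast (MarginBound.iidSample D m) (1 - δ)
            {S | ∀ h : X → Y, MarginBound.IsArgmaxPredictor (MarginBound.score φ w) h →
              MarginBound.misclassificationError D h ≤
                MarginBound.empiricalProb S {z | MarginBound.expectedMargin φ w z ≤ γ}
                  + C * MarginBound.rate c α γ δ m (Fintype.card Y) w}) ∧
        -- all weight vectors simultaneously, features of norm at most `R`
        (∀ R : ℝ, 0 < R → (∀ x y, ‖φ x y‖ ≤ R) →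
          MarginBound.ProbAtLeast (MarginBound.iidSample D m) (1 - δ)
            {S | ∀ (w : EuclideanSpace ℝ (Fin n)) (h : X → Y),
              MarginBound.IsArgmaxPredictor (MarginBound.score φ w) h →
              MarginBound.misclassificationError D h ≤
                MarginBound.empiricalProb S {z | MarginBound.expectedMargin φ w z ≤ γ}
                  + C * MarginBound.rate (c / R ^ 2) α γ δ m (Fintype.card Y) w}) := by
  refine ⟨4, 1 / 32, by norm_num, by norm_num, ?_⟩
  intro X Y _ _ _ _ _ n φ hφm D _ m hm δ hδ hδ1 γ hγ α hα0 hα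
  have hk : 1 ≤ Fintype.card Y := Fintype.card_pos
  have hE : ∀ (S : Fin m → X × Y) (w : EuclideanSpace ℝ (Fin n)) {r : ℝ}, r ≤ γ →
      empiricalProb S {z | margin (score φ w z.1) z.2 ≤ r}
        ≤ empiricalProb S {z | expectedMargin φ w z ≤ γ} := fun S w r hr =>
    empiricalProb_mono S fun z hz => (expectedMargin_le_margin w z).trans (le_trans hz hr)
  constructor
  · intro w
    -- At `δ = 1` the claim is void; the Hoeffding step needs ln(1/δ) > 0.
    rcases hδ1.eq_or_lt with rfl | hδ1
    · exact probAtLeast_of_one_le _ le_rfl _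
    have hB : MeasurableSet {z : X × Y | margin (score φ w z.1) z.2 ≤ 0} :=
      measurable_prodMk_left (x := w) (measurableSet_margin_le hφm 0)
    refine (probAtLeast_hoeffding D hm hB hδ hδ1).mono fun S hS h hh => ?_
    have h1 : √(Real.log δ⁻¹ / m) ≤ rate (1 / 32) α γ δ m (Fintype.card Y) w :=
      sqrt_log_le_rate w (by norm_num) hα hm hk
    linarith [misclassificationError_le_margin D hh, hE S w hγ.le, Set.mem_ofPred_eq ▸ hS,
      Real.sqrt_nonneg (Real.log δ⁻¹ / m)]
  · intro R hR hφ
    have hmk : (1 : ℝ) ≤ m * Fintype.card Y := by exact_mod_cast Nat.mul_pos hm hk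
    have hlog := Real.log_nonneg hmk
    refine (probAtLeast_pacBayes D hm
      (measurableSet_margin_le hφm √(8 * R ^ 2 * Real.log (m * Fintype.card Y))) hδ
      (fun j => √(m * (j + 1)))).mono fun S hS w h hh => ?_
    have h1 := margin_bound_of_pacBayes hm hφm D hR hγ hδ hδ1 hφ (Real.sqrt_nonneg _)
      (Real.sq_sqrt (by positivity)) S hS w
    have h2 : _ ≤ rate (1 / 32 / R ^ 2) α γ δ m (Fintype.card Y) w :=
      sqrt_le_rate (δ := δ) w hR hγ hα0 hα hm hk
    linarith [misclassificationError_le_margin D hh, hE S w le_rfl]
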